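/- A lattice path is a finite sequence of steps, each East $(1,0)$ or North $(0,1)$, starting at $(0,0)$. For integers $m,r\ge 0$ and lattice paths $P,Q$ from $(0,0)$ to $(m,r)$ with $P$ never going above $Q$, let $\mathcal P$ be the set of all lattice paths from $(0,0)$ to $(m,r)$ that go neither above $Q$ nor below $P$, and for $1\le i\le r$ let $N_i=\{j : \text{step } j \text{ is the } i\text{-th North step of some path in } \mathcal P\}$. Let $M[P,Q]$ be the transversal matroid on $\{1,2,\ldots,m+r\}$ with presentation $(N_1,\ldots,N_r)$, i.e. the matroid whose independent sets are the partial transversals of $(N_1,\ldots,N_r)$. A lattice path matroid is a matroid isomorphic to some $M[P,Q]$. For a matroid $M'$, a flat $F$ of $M'$ and an element $e\notin E(M')$, the principal extension of $M'$ by $e$ generated by $F$ is the matroid $N$ on $E(M')\cup\{e\}$ with $N|E(M')=M'$ such that, for every flat $G$ of $M'$, one has $e\in\mathrm{cl}_N(G)$ if and only if $F\subseteq G$. **Theorem.** A matroid $M$ is a lattice path matroid if and only if its ground set can be written as $\{x_1,x_2,\ldots,x_k\}$, with $x_1,\ldots,x_k$ distinct, so that for each $i$ with $1\le i\le k$ the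 restriction $M_i:=M|\{x_1,\ldots,x_i\}$ is formed from $M_{i-1}$ (with $M_0$ the empty matroid) in one of the following ways: (i) by adding $x_i$ as an isthmus, (ii) by adding $x_i$ as a loop, or (iii) by adding $x_i$ via the principal extension of $M_{i-1}$ generated by the closure $\mathrm{cl}_{M_{i-1}}(\{x_h,x_{h+1},\ldots,x_{i-1}\})$ of an independent set $\{x_h,x_{h+1},\ldots,x_{i-1}\}$ of $M_{i-1}$, for some $h$ with $1\le h<i$. -/

import Mathlib

open scoped Matroid

/-- A step of a lattice path: East is `(1,0)` and North is `(0,1)`. -/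
inductive LatticeStep where
  | east : LatticeStep
  | north : LatticeStep
  deriving DecidableEq

/-- The word `R` in the alphabet of steps is a lattice path from `(0,0)` to `(m,r)`. -/
def IsLatticePath (m r : ℕ) (R : List LatticeStep) : Prop :=
  R.count LatticeStep.east = m ∧ R.count LatticeStep.north = r

/-- The height (second coordinate) of the path `R` after its first `j` steps. -/
def pathHeight (R : List LatticeStep) (j : ℕ) : ℕ :=
  (R.take j).count LatticeStep.north

/-- The path `P` never goes above the path `Q`. After `j` steps both paths are on the line
`x + y = j`, so that their heights can be compared there. -/
def NeverAbove (P Q : List LatticeStep) : Prop :=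
  ∀ j : ℕ, pathHeight P j ≤ pathHeight Q j

/-- All lattice paths from `(0,0)` to `(m,r)` that go neither above `Q` nor below `P`. -/
def pathsBetween (m r : ℕ) (P Q : List LatticeStep) : Set (List LatticeStep) :=
  {R | IsLatticePath m r R ∧ NeverAbove P R ∧ NeverAbove R Q}

/-- Step `j` of `R` is the `i`-th North step of `R` (both counted from `1`). -/
def IsNthNorthStep (R : List LatticeStep) (i j : ℕ) : Prop :=
  1 ≤ j ∧ R[j - 1]? = some LatticeStep.north ∧ pathHeight R j = i

/-- The set `N_i` of all `j` such that step `j` is the `i`-th North step of some path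
between `P` and `Q`. -/
def northSet (m r : ℕ) (P Q : List LatticeStep) (i : ℕ) : Set ℕ :=
  {j | ∃ R ∈ pathsBetween m r P Q, IsNthNorthStep R i j}

/-- `I` is a partial transversal of the family `A`: its elements are distinct representatives
of distinctly indexed members of `A`. -/
def IsPartialTransversal {α ι : Type*} (A : ι → Set α) (I : Set α) : Prop :=
  ∃ f : I → ι, Function.Injective f ∧ ∀ x : I, (x : α) ∈ A (f x)

theorem IsPartialTransversal.subset {α ι : Type*} {A : ι → Set α} {I J : Set α}
    (hJ : IsPartialTransversal A J) (hIJ : I ⊆ J) : IsPartialTransversal A I := by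
  obtain ⟨f, hf, hfA⟩ := hJ
  exact ⟨fun x => f ⟨x, hIJ x.2⟩, fun x y h => by
    have := hf h
    simpa [Subtype.ext_iff] using this, fun x => hfA ⟨x, hIJ x.2⟩⟩

/-- The exchange step: choose matchings of `I` and `J` that agree as often as possible. -/
theorem IsPartialTransversal.augment {α ι : Type*} {A : ι → Set α} {I J : Set α}
    (hI : IsPartialTransversal A I) (hJ : IsPartialTransversal A J)
    (hIfin : I.Finite) (hJfin : J.Finite) (hcard : I.ncard < J.ncard) :
    ∃ e ∈ J, e ∉ I ∧ IsPartialTransversal A (insert e I) := by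
  classical
  obtain ⟨g, hg, hgA⟩ := hJ
  have : Finite I := hIfin
  have : Finite J := hJfin
  by_contra hcon
  push Not at hcon
  -- `D f` is the set of disagreements of `f` and `g` on `I ∩ J`
  let D : (I → ι) → Set α := fun f => {x | ∃ (hx : x ∈ I) (hy : x ∈ J), f ⟨x, hx⟩ ≠ g ⟨x, hy⟩}
  have key : ∀ n : ℕ, ∀ f : I → ι, Function.Injective f → (∀ x : I, (x : α) ∈ A (f x)) →
      (D f).ncard = n → False := by
    intro n
    induction n using Nat.strong_induction_on with
    | _ n ih =>
      intro f hf hfA hn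
      have hex : ∃ j : J, g j ∉ Set.range f := by
        by_contra hno
        push Not at hno
        have hsub : Set.range g ⊆ Set.range f := by
          rintro _ ⟨j, rfl⟩
          exact hno j
        have h1 := Set.ncard_le_ncard hsub (Set.finite_range f)
        rw [← Set.image_univ, ← Set.image_univ, Set.ncard_image_of_injective _ hg,
          Set.ncard_image_of_injective _ hf, Set.ncard_univ, Set.ncard_univ,
          Nat.card_coe_set_eq, Nat.card_coe_set_eq] at h1
        omega
      obtain ⟨j, hj⟩ := hex
      by_cases hjI : (j : α) ∈ I
      · let f' : I → ι := Function.update f ⟨j, hjI⟩ (g j)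
        have hf' : Function.Injective f' := by
          intro a b hab
          by_cases ha : a = ⟨j, hjI⟩ <;> by_cases hb : b = ⟨j, hjI⟩
          · rw [ha, hb]
          · simp only [f', ha, Function.update_self, Function.update_of_ne hb] at hab
            exact absurd ⟨b, hab.symm⟩ hj
          · simp only [f', hb, Function.update_self, Function.update_of_ne ha] at hab
            exact absurd ⟨a, hab⟩ hj
          · simp only [f', Function.update_of_ne ha, Function.update_of_ne hb] at hab
            exact hf hab
        have hfA' : ∀ x : I, (x : α) ∈ A (f' x) := by
          intro x
          by_cases hx : x = ⟨j, hjI⟩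
          · simp only [f', hx, Function.update_self]
            exact hgA j
          · simp only [f', Function.update_of_ne hx]
            exact hfA x
        refine ih (D f').ncard ?_ f' hf' hfA' rfl
        rw [← hn]
        apply Set.ncard_lt_ncard _ (hIfin.subset (fun x hx => hx.1))
        refine (Set.ssubset_iff_of_subset ?_).2 ⟨j, ?_, ?_⟩
        · rintro x ⟨hx, hy, hne⟩
          refine ⟨hx, hy, ?_⟩
          by_cases hxj : x = j
          · subst hxj
            simp [f'] at hne
          · have : (⟨x, hx⟩ : I) ≠ ⟨j, hjI⟩ := fun h => hxj (congrArg Subtype.val h)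
            simpa only [f', Function.update_of_ne this] using hne
        · exact ⟨hjI, j.2, fun h => hj ⟨_, h⟩⟩
        · rintro ⟨hx, hy, hne⟩
          simp [f'] at hne
      · refine hcon j j.2 hjI ⟨fun x => if hx : (x : α) ∈ I then f ⟨x, hx⟩ else g j, ?_, ?_⟩
        · rintro ⟨a, ha⟩ ⟨b, hb⟩ hab
          simp only [Subtype.mk.injEq]
          by_cases haI : a ∈ I <;> by_cases hbI : b ∈ I
          · simp only [haI, hbI, dif_pos] at hab
            exact congrArg Subtype.val (hf hab)
          · simp only [haI, hbI, dif_pos, dif_neg, not_false_eq_true] at hab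
            exact absurd ⟨_, hab⟩ hj
          · simp only [haI, hbI, dif_pos, dif_neg, not_false_eq_true] at hab
            exact absurd ⟨_, hab.symm⟩ hj
          · rw [ha.resolve_right haI, hb.resolve_right hbI]
        · rintro ⟨a, ha⟩
          by_cases haI : a ∈ I
          · simp only [haI, dif_pos]
            exact hfA ⟨a, haI⟩
          · simp only [haI, dif_neg, not_false_eq_true]
            rw [ha.resolve_right haI]
            exact hgA j
  obtain ⟨f, hf, hfA⟩ := hI
  exact key _ f hf hfA rfl

/-- The transversal matroid on the finite ground set `E` with presentation `A`: its independent
sets are the partial transversals of `A` in `E`. -/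
def transversalMatroid {α ι : Type*} (E : Set α) (hE : E.Finite) (A : ι → Set α) : Matroid α :=
  (IndepMatroid.ofFinite hE (fun I => I ⊆ E ∧ IsPartialTransversal A I)
    ⟨Set.empty_subset E, fun x => x.2.elim, fun x => x.2.elim, fun x => x.2.elim⟩
    (fun _ _ hJ hIJ => ⟨hIJ.trans hJ.1, hJ.2.subset hIJ⟩)
    (fun _ _ hI hJ hlt => by
      obtain ⟨e, heJ, heI, he⟩ :=
        hI.2.augment hJ.2 (hE.subset hI.1) (hE.subset hJ.1) hlt
      exact ⟨e, heJ, heI, Set.insert_subset (hJ.1 heJ) hI.1, he⟩)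
    (fun _ hI => hI.1)).matroid

/-- The matroid `M[P,Q]` of a pair of lattice paths from `(0,0)` to `(m,r)`: the transversal
matroid on `{1, …, m + r}` with presentation `(N_1, …, N_r)`. -/
def latticePathMatroid (m r : ℕ) (P Q : List LatticeStep) : Matroid ℕ :=
  transversalMatroid (Set.Icc 1 (m + r)) (Set.finite_Icc 1 (m + r))
    (fun i : Fin r => northSet m r P Q (i + 1))

/-- Isomorphism of matroids: a bijection of the ground sets that preserves independence in both
directions. -/
def MatroidIsomorphic {α β : Type*} (M : Matroid α) (N : Matroid β) : Prop :=
  ∃ e : M.E ≃ N.E, ∀ I : Set M.E,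
    M.Indep ((fun x : M.E => (x : α)) '' I) ↔ N.Indep ((fun x : M.E => (e x : β)) '' I)

/-- A lattice path matroid is, up to isomorphism, a matroid `M[P,Q]`, where `P` and `Q` are
lattice paths with the same endpoints and `P` never goes above `Q`. -/
def IsLatticePathMatroid {α : Type*} (M : Matroid α) : Prop :=
  ∃ (m r : ℕ) (P Q : List LatticeStep), IsLatticePath m r P ∧ IsLatticePath m r Q ∧
    NeverAbove P Q ∧ MatroidIsomorphic M (latticePathMatroid m r P Q)

/-- `N` is a single-element extension of `M` by the new element `e`. -/
def IsSingleElementExtension {α : Type*} (M : Matroid α) (e : α) (N : Matroid α) : Prop :=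
  e ∉ M.E ∧ N.E = insert e M.E ∧ N ↾ M.E = M

/-- `N` is formed from `M` by adding `e` as an isthmus. -/
def IsIsthmusExtension {α : Type*} (M : Matroid α) (e : α) (N : Matroid α) : Prop :=
  IsSingleElementExtension M e N ∧ N.IsColoop e

/-- `N` is formed from `M` by adding `e` as a loop. -/
def IsLoopExtension {α : Type*} (M : Matroid α) (e : α) (N : Matroid α) : Prop :=
  IsSingleElementExtension M e N ∧ N.IsLoop e

/-- `N` is formed from `M` by adding `e` via the principal extension of `M` generated by the
flat `F`: the single-element extension whose modular cut (the flats `G` of `M` that have `e` in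
their closure in `N`) consists of the flats of `M` that contain `F`. -/
def IsPrincipalExtension {α : Type*} (M : Matroid α) (F : Set α) (e : α) (N : Matroid α) : Prop :=
  IsSingleElementExtension M e N ∧ M.IsFlat F ∧
    ∀ G : Set α, M.IsFlat G → (e ∈ N.closure G ↔ F ⊆ G)

/-! Order the ground set and record a path by its height after each step. The `j`-th set of the
presentation then consists of the positions `e` with `P (e - 1) < j ≤ Q e`. Hall's condition for
these intervals reads `|I ∩ (w, v]| + P w ≤ Q v` for all `w ≤ v`
(`isPartialTransversal_northInterval_iff`), so independence becomes an inequality between heights.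

For independent `I ⊆ [1, i]`, adding `i + 1` only tests the windows `(w, i + 1]`. If `Q` goes North
at step `i + 1`, there is always room: an isthmus. If `Q` goes East and `P i = Q i`, there is none:
a loop. Otherwise let `h` be the largest start for which `[h, i]` fills its window completely.
Windows starting at or after position `h` impose nothing, and the earlier ones count `i + 1` exactly
as they count an element of `[h, i]`. So `i + 1` is added freely to the span of `[h, i]`
(`isSegmentStep_admissible`).

Conversely, the two paths are built step by step with a common endpoint
(`exists_heights_of_isSegmentStep`): an isthmus appends North to both, a loop appends East to both,
and a principal extension appends East to `Q` and inserts East into `P` as its `h`-th step.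

Both directions work for one fixed ordering of the ground set, so the equivalence is proved ordering
by ordering. -/

/-- `H` is the height function of an infinite word of East and North steps. -/
structure IsHeight (H : ℕ → ℕ) : Prop where
  zero : H 0 = 0
  le_succ : ∀ j, H j ≤ H (j + 1)
  succ_le : ∀ j, H (j + 1) ≤ H j + 1

namespace IsHeight

variable {H : ℕ → ℕ}

theorem mono (hH : IsHeight H) : Monotone H := monotone_nat_of_le_succ hH.le_succ

theorem le_add (hH : IsHeight H) (a d : ℕ) : H (a + d) ≤ H a + d := by
  induction d with
  | zero => simp
  | succ d ih =>
    have := hH.succ_le (a + d)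
    rw [← add_assoc]
    omega

theorem le_add_sub (hH : IsHeight H) {a b : ℕ} (hab : a ≤ b) : H b ≤ H a + (b - a) := by
  have := hH.le_add a (b - a)
  rwa [Nat.add_sub_cancel' hab] at this

end IsHeight

/-! ### Hall's condition for the interval presentation -/

/-- The set `I` of positions meets each interval `(w, v]` in at most `Q v - P w` elements. -/
def Admissible (P Q : ℕ → ℕ) (I : Set ℕ) : Prop :=
  ∀ w v, w ≤ v → (I ∩ Set.Ioc w v).ncard + P w ≤ Q v

/-- The positions at which a path between `P` and `Q` may have its `j`-th North step. -/
def northInterval (P Q : ℕ → ℕ) (j : ℕ) : Set ℕ :=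
  {e | 1 ≤ e ∧ P (e - 1) < j ∧ j ≤ Q e}

theorem finite_inter_Ioc (I : Set ℕ) (w v : ℕ) : (I ∩ Set.Ioc w v).Finite :=
  (Set.finite_Ioc w v).subset Set.inter_subset_right

theorem ncard_inter_Ioc_le (I : Set ℕ) (w v : ℕ) : (I ∩ Set.Ioc w v).ncard ≤ v - w := by
  have h := Set.ncard_le_ncard (Set.inter_subset_right : I ∩ Set.Ioc w v ⊆ _)
    (Set.finite_Ioc w v)
  rwa [← Finset.coe_Ioc, Set.ncard_coe_finset, Nat.card_Ioc, Finset.coe_Ioc] at h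

theorem ncard_inter_Ioc_mono {I J : Set ℕ} {w v w' v' : ℕ}
    (h : I ∩ Set.Ioc w v ⊆ J ∩ Set.Ioc w' v') :
    (I ∩ Set.Ioc w v).ncard ≤ (J ∩ Set.Ioc w' v').ncard :=
  Set.ncard_le_ncard h (finite_inter_Ioc _ _ _)

theorem ncard_insert_inter_Ioc {I : Set ℕ} {e w v : ℕ} (he : e ∉ I) (hw : w < e) (hv : e ≤ v) :
    (insert e I ∩ Set.Ioc w v).ncard = (I ∩ Set.Ioc w v).ncard + 1 := by
  rw [Set.insert_inter_of_mem (Set.mem_Ioc.2 ⟨hw, hv⟩),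
    Set.ncard_insert_of_notMem (fun h => he h.1) (finite_inter_Ioc _ _ _)]

theorem Admissible.subset {P Q : ℕ → ℕ} {I J : Set ℕ} (hJ : Admissible P Q J) (hIJ : I ⊆ J) :
    Admissible P Q I := fun w v hwv =>
  (Nat.add_le_add_right (ncard_inter_Ioc_mono (Set.inter_subset_inter_left _ hIJ)) _).trans
    (hJ w v hwv)

/-- Necessity in Hall's condition: by monotonicity, positions in `(w, v]` can only be matched to
indices in `(P w, Q v]`. -/
theorem IsPartialTransversal.admissible {P Q : ℕ → ℕ} (hP : IsHeight P) (hQ : IsHeight Q)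
    (hPQ : ∀ j, P j ≤ Q j) {I : Set ℕ} (hI : IsPartialTransversal (northInterval P Q) I) :
    Admissible P Q I := by
  classical
  intro w v hwv
  obtain ⟨f, hf, hfA⟩ := hI
  have h1 : (I ∩ Set.Ioc w v).ncard ≤ (Set.Ioc (P w) (Q v)).ncard := by
    refine Set.ncard_le_ncard_of_injOn (fun y => if h : y ∈ I then f ⟨y, h⟩ else 0) ?_ ?_
      (Set.finite_Ioc _ _)
    · rintro y ⟨hy, hwy, hyv⟩
      obtain ⟨_, h2, h3⟩ := hfA ⟨y, hy⟩
      simp only [hy, dif_pos]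
      exact ⟨(hP.mono (by simp only; omega)).trans_lt h2, h3.trans (hQ.mono hyv)⟩
    · rintro y ⟨hy, _⟩ z ⟨hz, _⟩ hyz
      simp only [hy, hz, dif_pos] at hyz
      exact congrArg Subtype.val (hf hyz)
  rw [← Finset.coe_Ioc (P w), Set.ncard_coe_finset, Nat.card_Ioc] at h1
  have := (hPQ w).trans (hQ.mono hwv)
  omega

open Classical in
/-- The lowest path that stays above `P` and has North steps at the positions in `I`. -/
noncomputable def lowestPath (P : ℕ → ℕ) (I : Set ℕ) : ℕ → ℕ
  | 0 => 0
  | v + 1 => if v + 1 ∈ I then lowestPath P I v + 1 else max (lowestPath P I v) (P (v + 1))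

theorem le_lowestPath {P : ℕ → ℕ} (hP : IsHeight P) (I : Set ℕ) (v : ℕ) :
    P v ≤ lowestPath P I v := by
  induction v with
  | zero => simp [hP.zero]
  | succ v ih =>
    have := hP.succ_le v
    rw [lowestPath]
    split_ifs
    · omega
    · exact le_max_right _ _

theorem lowestPath_mono (P : ℕ → ℕ) (I : Set ℕ) : Monotone (lowestPath P I) := by
  refine monotone_nat_of_le_succ fun v => ?_
  rw [lowestPath]
  split_ifs
  · omega
  · exact le_max_left _ _

/-- Take for `w` the last moment at which the greedy path had to be on `P`; after it, only steps in
`I` raise the path. -/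
theorem exists_lowestPath_le (P : ℕ → ℕ) (I : Set ℕ) (v : ℕ) :
    ∃ w ≤ v, lowestPath P I v ≤ (I ∩ Set.Ioc w v).ncard + P w := by
  induction v with
  | zero => exact ⟨0, le_rfl, by simp [lowestPath]⟩
  | succ v ih =>
    obtain ⟨w, hw, h⟩ := ih
    rw [lowestPath]
    split_ifs with hv
    · refine ⟨w, by omega, ?_⟩
      have : I ∩ Set.Ioc w (v + 1) = insert (v + 1) (I ∩ Set.Ioc w v) := by
        ext y
        simp only [Set.mem_inter_iff, Set.mem_Ioc, Set.mem_insert_iff]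
        constructor
        · rintro ⟨h1, h2, h3⟩
          by_cases hy : y = v + 1
          · exact Or.inl hy
          · exact Or.inr ⟨h1, h2, by omega⟩
        · rintro (rfl | ⟨h1, h2, h3⟩)
          · exact ⟨hv, by omega, le_rfl⟩
          · exact ⟨h1, h2, by omega⟩
      rw [this, Set.ncard_insert_of_notMem (by simp) (finite_inter_Ioc _ _ _)]
      omega
    · rcases le_total (lowestPath P I v) (P (v + 1)) with h' | h'
      · exact ⟨v + 1, le_rfl, by rw [max_eq_right h']; omega⟩
      · refine ⟨w, by omega, ?_⟩
        rw [max_eq_left h']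
        refine h.trans (Nat.add_le_add_right (ncard_inter_Ioc_mono ?_) _)
        exact Set.inter_subset_inter_right _ (Set.Ioc_subset_Ioc_right (by omega))

/-- Sufficiency in Hall's condition: match each position with the height that the lowest path
reaches there. The path rises at every element of `I`, which gives injectivity, and admissibility at
the last contact with `P` keeps it below `Q`. -/
theorem Admissible.isPartialTransversal {P Q : ℕ → ℕ} (hP : IsHeight P)
    {I : Set ℕ} (hI : Admissible P Q I) (h0 : 0 ∉ I) :
    IsPartialTransversal (northInterval P Q) I := by
  have key : ∀ e ∈ I, lowestPath P I e = lowestPath P I (e - 1) + 1 := by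
    intro e he
    obtain ⟨d, rfl⟩ := Nat.exists_eq_succ_of_ne_zero (n := e) (by rintro rfl; exact h0 he)
    simp only [Nat.succ_eq_add_one] at he ⊢
    rw [lowestPath, if_pos he]
    simp
  have hlt : ∀ a b : I, (a : ℕ) < b → lowestPath P I a < lowestPath P I b := by
    intro a b hab
    rw [key b b.2]
    have := lowestPath_mono P I (show (a : ℕ) ≤ b - 1 by omega)
    omega
  refine ⟨fun e => lowestPath P I e, ?_, ?_⟩
  · intro a b hab
    rcases lt_trichotomy (a : ℕ) b with h | h | h
    · exact absurd hab (hlt a b h).ne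
    · exact Subtype.ext h
    · exact absurd hab (hlt b a h).ne'
  · rintro ⟨e, he⟩
    refine ⟨Nat.one_le_iff_ne_zero.2 (by rintro rfl; exact h0 he), ?_, ?_⟩
    · have h1 := key e he
      have h2 := le_lowestPath hP I (e - 1)
      simp only
      omega
    · obtain ⟨w, hw, h⟩ := exists_lowestPath_le P I e
      exact h.trans (hI w e hw)

theorem isPartialTransversal_northInterval_iff {P Q : ℕ → ℕ} (hP : IsHeight P) (hQ : IsHeight Q)
    (hPQ : ∀ j, P j ≤ Q j) {I : Set ℕ} (h0 : 0 ∉ I) :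
    IsPartialTransversal (northInterval P Q) I ↔ Admissible P Q I :=
  ⟨fun h => h.admissible hP hQ hPQ, fun h => h.isPartialTransversal hP h0⟩

theorem transversalMatroid_indep_iff {α ι : Type*} {E : Set α} {hE : E.Finite} {A : ι → Set α}
    {I : Set α} : (transversalMatroid E hE A).Indep I ↔ I ⊆ E ∧ IsPartialTransversal A I :=
  Iff.rfl

/-! ### Paths as lists of steps -/

theorem pathHeight_succ (R : List LatticeStep) (j : ℕ) :
    pathHeight R (j + 1) = pathHeight R j + if R[j]? = some LatticeStep.north then 1 else 0 := by
  unfold pathHeight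
  rw [List.take_add_one, List.count_append]
  congr 1
  cases h : R[j]? with
  | none => simp
  | some s => cases s <;> simp

theorem isHeight_pathHeight (R : List LatticeStep) : IsHeight (pathHeight R) where
  zero := by simp [pathHeight]
  le_succ j := by rw [pathHeight_succ]; omega
  succ_le j := by rw [pathHeight_succ]; split_ifs <;> omega

theorem length_eq_count_add_count (R : List LatticeStep) :
    R.length = R.count LatticeStep.east + R.count LatticeStep.north := by
  induction R with
  | nil => rfl
  | cons s R ih => cases s <;> simp [ih] <;> omega

theorem IsLatticePath.length {m r : ℕ} {R : List LatticeStep} (hR : IsLatticePath m r R) :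
    R.length = m + r := by
  rw [length_eq_count_add_count, hR.1, hR.2]

theorem IsLatticePath.pathHeight_of_le {m r : ℕ} {R : List LatticeStep}
    (hR : IsLatticePath m r R) {j : ℕ} (hj : m + r ≤ j) : pathHeight R j = r := by
  rw [pathHeight, List.take_of_length_le (by rw [hR.length]; exact hj), hR.2]

theorem IsHeight.exists_list {H : ℕ → ℕ} (hH : IsHeight H) {n : ℕ} (hn : ∀ j, n ≤ j → H j = H n) :
    ∃ R : List LatticeStep, IsLatticePath (n - H n) (H n) R ∧ pathHeight R = H := by
  classical
  let R : List LatticeStep := (List.range n).map fun k =>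
    if H (k + 1) = H k + 1 then LatticeStep.north else LatticeStep.east
  have hR : ∀ j, pathHeight R j = H j := by
    intro j
    induction j with
    | zero => rw [hH.zero, (isHeight_pathHeight R).zero]
    | succ j ih =>
      have h1 := hH.le_succ j
      have h2 := hH.succ_le j
      rw [pathHeight_succ, ih]
      by_cases hj : j < n
      · have : R[j]? = some (if H (j + 1) = H j + 1 then LatticeStep.north
            else LatticeStep.east) := by
          simp [R, hj]
        rw [this]
        by_cases h : H (j + 1) = H j + 1
        · simp [h]
        · simp [h]
          omega
      · have : R[j]? = none := by simp [R]; omega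
        rw [this, hn j (by omega), hn (j + 1) (by omega)]
        simp
  have hlen : R.length = n := by simp [R]
  have hnorth : R.count LatticeStep.north = H n := by
    rw [← hR n, pathHeight, List.take_of_length_le hlen.le]
  refine ⟨R, ⟨?_, hnorth⟩, funext hR⟩
  have := length_eq_count_add_count R
  omega

/-- Through each position that the bounds allow there is a path with its `i`-th North step there. -/
theorem exists_isHeight_between {P Q : ℕ → ℕ} (hP : IsHeight P) (hQ : IsHeight Q)
    (hPQ : ∀ j, P j ≤ Q j) {i j : ℕ} (hj : j + 1 ∈ northInterval P Q i) :
    ∃ H, IsHeight H ∧ (∀ l, P l ≤ H l) ∧ (∀ l, H l ≤ Q l) ∧ H j + 1 = i ∧ H (j + 1) = i := by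
  obtain ⟨-, h1, h2⟩ := hj
  simp only [Nat.add_sub_cancel] at h1
  -- The path is the function that jumps from `i - 1` to `i` at step `j + 1`, clamped between `P`
  -- and `Q`.
  refine ⟨fun l => max (P l) (min (Q l) (if l ≤ j then i - 1 else i)), ⟨?_, ?_, ?_⟩, ?_, ?_, ?_, ?_⟩
  · simp [hP.zero, hQ.zero]
  · intro l
    have := hP.le_succ l
    have := hQ.le_succ l
    split_ifs <;> omega
  · intro l
    have := hP.succ_le l
    have := hQ.succ_le l
    have := hPQ l
    rcases lt_trichotomy l j with h | rfl | h
    · simp only [h.le, Nat.succ_le_of_lt h, if_true]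
      omega
    · simp only [le_refl, if_true, show ¬ l + 1 ≤ l by omega, if_false]
      omega
    · simp only [show ¬ l ≤ j by omega, show ¬ l + 1 ≤ j by omega, if_false]
      omega
  · intro l
    exact le_max_left _ _
  · intro l
    exact max_le (hPQ l) (min_le_left _ _)
  · have := hQ.succ_le j
    simp only [le_refl, if_true]
    omega
  · have := hP.succ_le j
    simp only [show ¬ j + 1 ≤ j by omega, if_false]
    omega

theorem northSet_eq {m r : ℕ} {P Q : List LatticeStep} (hP : IsLatticePath m r P)
    (hQ : IsLatticePath m r Q) (hPQ : NeverAbove P Q) (i : ℕ) :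
    northSet m r P Q i = northInterval (pathHeight P) (pathHeight Q) i := by
  ext j
  constructor
  · rintro ⟨R, ⟨-, hPR, hRQ⟩, hj, hRj, rfl⟩
    obtain ⟨l, rfl⟩ := Nat.exists_eq_add_of_le' hj
    simp only [Nat.add_sub_cancel] at hRj
    refine ⟨hj, ?_, hRQ _⟩
    rw [Nat.add_sub_cancel, pathHeight_succ, if_pos hRj]
    exact Nat.lt_succ_of_le (hPR l)
  · intro hj
    obtain ⟨l, rfl⟩ := Nat.exists_eq_add_of_le' hj.1
    obtain ⟨H, hH, hPH, hHQ, h1, h2⟩ := exists_isHeight_between (isHeight_pathHeight P)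
      (isHeight_pathHeight Q) hPQ hj
    -- Squeezed between `P` and `Q`, the new path has the right endpoint.
    have hend : ∀ k, m + r ≤ k → H k = r := fun k hk =>
      le_antisymm ((hHQ k).trans (hQ.pathHeight_of_le hk).le)
        ((hP.pathHeight_of_le hk).symm.le.trans (hPH k))
    obtain ⟨R, hR, rfl⟩ := hH.exists_list (n := m + r)
      fun k hk => by rw [hend k hk, hend _ le_rfl]
    rw [hend _ le_rfl, Nat.add_sub_cancel] at hR
    refine ⟨R, ⟨hR, hPH, hHQ⟩, hj.1, ?_, h2⟩
    rw [pathHeight_succ] at h2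
    rw [Nat.add_sub_cancel]
    by_contra hne
    rw [if_neg hne] at h2
    omega

/-- Empty members are never used by a matching, so the family indexed by `Fin r` may be replaced by
one indexed by all of `ℕ`. -/
theorem IsPartialTransversal.comp_iff {α ι κ : Type*} {A : ι → Set α} {g : κ → ι}
    (hg : Function.Injective g) (hA : ∀ i, i ∉ Set.range g → A i = ∅) {I : Set α} :
    IsPartialTransversal (fun k => A (g k)) I ↔ IsPartialTransversal A I := by
  constructor
  · rintro ⟨f, hf, hfA⟩
    exact ⟨g ∘ f, hg.comp hf, hfA⟩
  · rintro ⟨f, hf, hfA⟩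
    have hmem : ∀ y, f y ∈ Set.range g := fun y => by
      by_contra h
      have := hfA y
      rw [hA _ h] at this
      exact this
    choose f' hf' using hmem
    refine ⟨f', fun a b hab => hf ?_, fun y => ?_⟩
    · rw [← hf' a, ← hf' b, hab]
    · simpa only [hf'] using hfA y

theorem latticePathMatroid_ground (m r : ℕ) (P Q : List LatticeStep) :
    (latticePathMatroid m r P Q).E = Set.Icc 1 (m + r) := rfl

theorem latticePathMatroid_indep_iff {m r : ℕ} {P Q : List LatticeStep}
    (hP : IsLatticePath m r P) (hQ : IsLatticePath m r Q) (hPQ : NeverAbove P Q) {I : Set ℕ} :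
    (latticePathMatroid m r P Q).Indep I ↔
      I ⊆ Set.Icc 1 (m + r) ∧ Admissible (pathHeight P) (pathHeight Q) I := by
  rw [latticePathMatroid, transversalMatroid_indep_iff]
  refine and_congr_right fun hI => ?_
  rw [← isPartialTransversal_northInterval_iff (isHeight_pathHeight P) (isHeight_pathHeight Q) hPQ
    (fun h => by simpa using (hI h).1)]
  simp only [northSet_eq hP hQ hPQ]
  refine IsPartialTransversal.comp_iff (A := northInterval (pathHeight P) (pathHeight Q))
    (g := fun i : Fin r => (i : ℕ) + 1) (fun a b hab => Fin.ext (by simpa using hab)) ?_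
  intro i hi
  rw [Set.eq_empty_iff_forall_notMem]
  rintro e ⟨-, h1, h2⟩
  refine hi ⟨⟨i - 1, ?_⟩, ?_⟩
  · have h3 : pathHeight Q e ≤ r := by
      rw [← hQ.pathHeight_of_le (le_max_right e (m + r))]
      exact (isHeight_pathHeight Q).mono (le_max_left _ _)
    omega
  · simp only
    omega

/-! ### Single-element extensions in terms of independent sets -/

section Extensions

variable {α : Type*} {M : Matroid α} {A F : Set α} {e : α}

theorem isSingleElementExtension_restrict (he : e ∉ A) :
    IsSingleElementExtension (M ↾ A) e (M ↾ (insert e A)) :=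
  ⟨he, rfl, M.restrict_restrict_eq (Set.subset_insert e A)⟩

theorem mem_restrict_closure_insert_iff (hA : A ⊆ M.E) (he : e ∈ M.E) {G : Set α} (hG : G ⊆ A) :
    e ∈ (M ↾ (insert e A)).closure G ↔ e ∈ M.closure G := by
  rw [M.restrict_closure_eq (hG.trans (Set.subset_insert e A)) (Set.insert_subset he hA)]
  simp

theorem isIsthmusExtension_restrict_iff (hA : A ⊆ M.E) (he : e ∈ M.E) (heA : e ∉ A) :
    IsIsthmusExtension (M ↾ A) e (M ↾ (insert e A)) ↔
      ∀ I ⊆ A, M.Indep I → M.Indep (insert e I) := by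
  have h1 : (M ↾ (insert e A)).IsColoop e ↔ e ∉ M.closure A := by
    rw [Matroid.isColoop_iff_notMem_closure_compl (by simp)]
    simp only [Matroid.restrict_ground_eq, Set.insert_sdiff_of_mem _ (Set.mem_singleton e),
      Set.sdiff_singleton_eq_self heA]
    rw [mem_restrict_closure_insert_iff hA he le_rfl]
  rw [IsIsthmusExtension, and_iff_right (isSingleElementExtension_restrict heA), h1]
  constructor
  · intro h I hIA hI
    have := fun h' => h (M.closure_subset_closure hIA h')
    exact ((hI.notMem_closure_iff he).1 this).1
  · intro h
    obtain ⟨I, hI⟩ := M.exists_isBasis A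
    rw [← hI.closure_eq_closure, hI.indep.notMem_closure_iff he]
    exact ⟨h I hI.subset hI.indep, fun h => heA (hI.subset h)⟩

theorem isLoopExtension_restrict_iff (heA : e ∉ A) :
    IsLoopExtension (M ↾ A) e (M ↾ (insert e A)) ↔ ∀ I ⊆ A, ¬ M.Indep (insert e I) := by
  rw [IsLoopExtension, and_iff_right (isSingleElementExtension_restrict heA),
    ← Matroid.singleton_not_indep (by simp), Matroid.restrict_indep_iff]
  constructor
  · intro h I _ hI
    exact h ⟨hI.subset (by simp), by simp⟩
  · rintro h ⟨h', -⟩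
    exact h ∅ (Set.empty_subset _) (by simpa using h')

theorem exists_insert_indep_iff (hF : F ⊆ M.E) {I : Set α} (hI : M.Indep I) :
    (∃ f ∈ F, f ∉ I ∧ M.Indep (insert f I)) ↔ ¬ F ⊆ M.closure I := by
  rw [Set.not_subset]
  refine exists_congr fun f => and_congr_right fun hf => ?_
  rw [hI.notMem_closure_iff (hF hf), and_comm]

/-- Every flat is the closure of a basis `I` of it, so the modular cut is determined by the
statements "`e` is spanned by `I` iff `F` is". Negating both sides turns spanning into augmentation
of `I`. -/
theorem isPrincipalExtension_restrict_iff (hA : A ⊆ M.E) (he : e ∈ M.E) (heA : e ∉ A)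
    (hF : F ⊆ A) :
    IsPrincipalExtension (M ↾ A) ((M ↾ A).closure F) e (M ↾ (insert e A)) ↔
      ∀ I ⊆ A, M.Indep I →
        (M.Indep (insert e I) ↔ ∃ f ∈ F, f ∉ I ∧ M.Indep (insert f I)) := by
  rw [IsPrincipalExtension, and_iff_right (isSingleElementExtension_restrict heA),
    and_iff_right (Matroid.isFlat_closure _)]
  have key : ∀ I ⊆ A, M.Indep I →
      ((M.Indep (insert e I) ↔ ∃ f ∈ F, f ∉ I ∧ M.Indep (insert f I)) ↔
        (e ∈ M.closure I ↔ F ⊆ M.closure I)) := by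
    intro I hIA hI
    have heI : e ∉ I := fun h => heA (hIA h)
    rw [exists_insert_indep_iff (hF.trans hA) hI,
      ← hI.notMem_closure_iff_of_notMem heI he, not_iff_not]
  have hcl : ∀ I ⊆ A, (F ⊆ (M ↾ A).closure I ↔ F ⊆ M.closure I) := by
    intro I hIA
    rw [M.restrict_closure_eq hIA hA, Set.subset_inter_iff, and_iff_left hF]
  constructor
  · intro h I hIA hI
    rw [key I hIA hI]
    have h1 := h _ ((M ↾ A).isFlat_closure I)
    rw [Matroid.closure_subset_closure_iff_subset_closure (by exact hF), hcl I hIA] at h1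
    rw [← h1, mem_restrict_closure_insert_iff hA he ((M ↾ A).closure_subset_ground I),
      M.restrict_closure_eq hIA hA]
    refine ⟨fun h => ?_, fun h => ?_⟩
    · refine M.closure_subset_closure (Set.subset_inter (M.subset_closure I) hIA) h
    · rw [← M.closure_closure I]
      exact M.closure_subset_closure Set.inter_subset_left h
  · intro h G hG
    have hGA : G ⊆ A := hG.subset_ground
    obtain ⟨I, hI⟩ := M.exists_isBasis G (hGA.trans hA)
    have hIA := hI.subset.trans hGA
    have h1 := (key I hIA hI.indep).1 (h I hIA hI.indep)
    rw [mem_restrict_closure_insert_iff hA he hGA, ← hI.closure_eq_closure, h1,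
      ← hcl I hIA, M.restrict_closure_eq hIA hA, hI.closure_eq_closure,
      ← M.restrict_closure_eq hGA hA, hG.closure]
    exact ⟨fun h => ((M ↾ A).closure_subset_closure h).trans hG.closure.subset,
      fun h => ((M ↾ A).subset_closure F hF).trans h⟩

end Extensions

/-! ### The elementary form of the three extensions on an initial segment -/

/-- Adding `i + 1` to the segment `[1, i]` in a family `p` of sets as an isthmus, as a loop, or
by a principal extension generated by the member `[h, i]` of `p`. -/
def IsSegmentStep (p : Set ℕ → Prop) (i : ℕ) : Prop :=
  (∀ I ⊆ Set.Icc 1 i, p I → p (insert (i + 1) I)) ∨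
  (∀ I ⊆ Set.Icc 1 i, ¬ p (insert (i + 1) I)) ∨
  ∃ h, 1 ≤ h ∧ h ≤ i ∧ p (Set.Icc h i) ∧ ∀ I ⊆ Set.Icc 1 i, p I →
    (p (insert (i + 1) I) ↔ ∃ f ∈ Set.Icc h i, f ∉ I ∧ p (insert f I))

/-! ### From a pair of paths to segment steps -/

section Admissible

variable {P Q : ℕ → ℕ}

/-- Admissible subsets of a segment are the independent sets of a matroid. -/
theorem exists_matroid_admissible (hP : IsHeight P) (hQ : IsHeight Q) (hPQ : ∀ j, P j ≤ Q j)
    (n : ℕ) : ∃ N : Matroid ℕ, N.E = Set.Icc 1 n ∧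
      ∀ I ⊆ Set.Icc 1 n, (N.Indep I ↔ Admissible P Q I) := by
  refine ⟨transversalMatroid (Set.Icc 1 n) (Set.finite_Icc 1 n) (northInterval P Q), rfl,
    fun I hI => ?_⟩
  rw [transversalMatroid_indep_iff, and_iff_right hI,
    isPartialTransversal_northInterval_iff hP hQ hPQ (fun h => by simpa using (hI h).1)]

/-- Only windows that contain `i + 1` gain an element, and among those with a given start the one
ending at `i + 1` is the tightest, since `Q` is monotone. -/
theorem admissible_insert_succ_iff (hQ : IsHeight Q) {i : ℕ} {I : Set ℕ}
    (hI : I ⊆ Set.Icc 1 i) (hadm : Admissible P Q I) :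
    Admissible P Q (insert (i + 1) I) ↔
      ∀ w ≤ i, (I ∩ Set.Ioc w i).ncard + 1 + P w ≤ Q (i + 1) := by
  have hiI : i + 1 ∉ I := fun h => by have := (hI h).2; omega
  have hcut : ∀ w v, i ≤ v → I ∩ Set.Ioc w v = I ∩ Set.Ioc w i := by
    intro w v hv
    ext y
    refine and_congr_right fun hy => ?_
    have := (hI hy).2
    simp only [Set.mem_Ioc]
    omega
  constructor
  · intro h w hw
    have := h w (i + 1) (by omega)
    rwa [ncard_insert_inter_Ioc hiI (by omega) le_rfl, hcut _ _ (by omega)] at this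
  · intro h w v hwv
    by_cases hw : w ≤ i ∧ i + 1 ≤ v
    · rw [ncard_insert_inter_Ioc hiI (by omega) hw.2, hcut _ _ (by omega)]
      exact (h w hw.1).trans (hQ.mono hw.2)
    · rw [Set.insert_inter_of_notMem (by simp only [Set.mem_Ioc]; omega)]
      exact hadm w v hwv

/-- The set `[h, i]` can be matched when there is room for it below `Q` at the end. -/
theorem admissible_Icc (hP : IsHeight P) (hQ : IsHeight Q) (hPQ : ∀ j, P j ≤ Q j) {h i : ℕ}
    (h1 : 1 ≤ h) (hi : h ≤ i) (hroom : P (h - 1) + (i + 1 - h) ≤ Q i) :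
    Admissible P Q (Set.Icc h i) := by
  intro w v hwv
  have hsub : Set.Icc h i ∩ Set.Ioc w v ⊆
      Set.univ ∩ Set.Ioc (max w (h - 1)) (min v i) := by
    rintro y ⟨⟨_, _⟩, _, _⟩
    simp only [Set.univ_inter, Set.mem_Ioc]
    omega
  have h2 := (ncard_inter_Ioc_mono hsub).trans (ncard_inter_Ioc_le _ _ _)
  have h3 := hQ.le_add_sub (min_le_right v i)
  have h4 := hP.le_add_sub (le_max_right w (h - 1))
  have h5 := hP.mono (le_max_left w (h - 1))
  have h6 := (hPQ w).trans (hQ.mono hwv)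
  have h7 := hQ.mono (min_le_left v i)
  omega

/-- `hfull` says that `[h, i]` leaves no room for `i + 1`, hence spans it; `hroom` says that windows
starting at or after position `h` never obstruct the insertion. -/
theorem admissible_insert_succ_iff_exists (hP : IsHeight P) (hQ : IsHeight Q) (hPQ : ∀ j, P j ≤ Q j) {h i : ℕ}
    (h1 : 1 ≤ h) (hi : h ≤ i) (hQi : Q (i + 1) = Q i) (hF : Admissible P Q (Set.Icc h i))
    (hfull : Q i ≤ P (h - 1) + (i + 1 - h))
    (hroom : ∀ w, h ≤ w → w ≤ i → P w + (i - w) < Q i) {I : Set ℕ} (hI : I ⊆ Set.Icc 1 i)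
    (hadm : Admissible P Q I) :
    Admissible P Q (insert (i + 1) I) ↔
      ∃ f ∈ Set.Icc h i, f ∉ I ∧ Admissible P Q (insert f I) := by
  have hiI : i + 1 ∉ I := fun h => by have := (hI h).2; omega
  constructor
  · intro hins
    obtain ⟨N, hNE, hN⟩ := exists_matroid_admissible hP hQ hPQ (i + 1)
    have hseg : Set.Icc 1 i ⊆ Set.Icc 1 (i + 1) := Set.Icc_subset_Icc_right (by omega)
    have hFseg : Set.Icc h i ⊆ Set.Icc 1 (i + 1) := Set.Icc_subset_Icc h1 (by omega)
    have hmem : i + 1 ∈ Set.Icc 1 (i + 1) := ⟨by omega, le_rfl⟩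
    have hIN := (hN I (hI.trans hseg)).2 hadm
    have hFN := (hN _ hFseg).2 hF
    have hins' := (hN _ (Set.insert_subset hmem (hI.trans hseg))).2 hins
    -- If no element of `[h, i]` augments `I`, then `I` spans `[h, i]`, which spans `i + 1`.
    by_contra hno
    have hsub : Set.Icc h i ⊆ N.closure I := by
      by_contra hns
      obtain ⟨f, hf, hfI, hfN⟩ := (exists_insert_indep_iff (hNE ▸ hFseg) hIN).2 hns
      exact hno ⟨f, hf, hfI,
        (hN _ (Set.insert_subset (hFseg hf) (hI.trans hseg))).1 hfN⟩
    have hcl : i + 1 ∈ N.closure (Set.Icc h i) := by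
      by_contra hncl
      rw [hFN.notMem_closure_iff (hNE ▸ hmem), hN _ (Set.insert_subset hmem hFseg)] at hncl
      have h2 := hncl.1 (h - 1) (i + 1) (by omega)
      rw [ncard_insert_inter_Ioc (by simp) (by omega) le_rfl,
        Set.inter_eq_left.2 (fun y hy => Set.mem_Ioc.2 ⟨by have := hy.1; omega, by have := hy.2; omega⟩),
        ← Finset.coe_Icc, Set.ncard_coe_finset, Nat.card_Icc] at h2
      omega
    have hcl' : i + 1 ∈ N.closure I := by
      rw [← N.closure_closure I]
      exact N.closure_subset_closure hsub hcl
    exact ((hIN.notMem_closure_iff (hNE ▸ hmem)).2 ⟨hins', hiI⟩) hcl'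
  · rintro ⟨f, ⟨hhf, hfi⟩, hfI, hf⟩
    rw [admissible_insert_succ_iff hQ hI hadm]
    intro w hw
    rw [hQi]
    by_cases hwh : h ≤ w
    · have h2 := ncard_inter_Ioc_le I w i
      have h3 := hroom w hwh hw
      omega
    -- A window starting before `h` counts `f` just as it would count `i + 1`.
    · have h2 := hf w i hw
      rwa [ncard_insert_inter_Ioc hfI (by omega) hfi] at h2

theorem isSegmentStep_admissible (hP : IsHeight P) (hQ : IsHeight Q) (hPQ : ∀ j, P j ≤ Q j)
    (i : ℕ) : IsSegmentStep (Admissible P Q) i := by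
  have h1 := hQ.le_succ i
  have h2 := hQ.succ_le i
  have h3 := hPQ i
  by_cases hQi : Q (i + 1) = Q i
  · by_cases hPi : P i = Q i
    · refine Or.inr (Or.inl fun I hI hadm => ?_)
      rw [admissible_insert_succ_iff hQ hI (hadm.subset (Set.subset_insert _ _))] at hadm
      have := hadm i le_rfl
      omega
    -- The least such `l` is the size of the generating set `[i + 1 - l, i]`; the spec of the
    -- minimum gives `hfull` and its minimality gives `hroom`.
    · have hex : ∃ l, Q i ≤ P (i - l) + l := by
        refine ⟨i, ?_⟩
        have := hQ.le_add 0 i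
        rw [hQ.zero, zero_add] at this
        omega
      classical
      have hspec := Nat.find_spec hex
      have hmin := fun l => Nat.find_min hex (m := l)
      set k := Nat.find hex
      have hk0 : k ≠ 0 := by
        intro hk
        rw [hk] at hspec
        simp only [Nat.sub_zero] at hspec
        omega
      have hki : k ≤ i := by
        by_contra hlt
        have := hmin i (by omega)
        have h4 := hQ.le_add 0 i
        rw [hQ.zero, zero_add] at h4
        omega
      have hroom : ∀ w, i + 1 - k ≤ w → w ≤ i → P w + (i - w) < Q i := by
        intro w hw hwi
        have := hmin (i - w) (by omega)
        rw [Nat.sub_sub_self hwi] at this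
        omega
      have hidx : i + 1 - k - 1 = i - k := by omega
      have hF : Admissible P Q (Set.Icc (i + 1 - k) i) := by
        refine admissible_Icc hP hQ hPQ (by omega) (by omega) ?_
        have h5 := hroom (i + 1 - k) le_rfl (by omega)
        have h6 := hP.mono (show i - k ≤ i + 1 - k by omega)
        rw [hidx]
        omega
      refine Or.inr (Or.inr ⟨i + 1 - k, by omega, by omega, hF, fun I hI hadm => ?_⟩)
      refine admissible_insert_succ_iff_exists hP hQ hPQ (by omega) (by omega) hQi hF ?_ hroom hI hadm
      rw [hidx]
      omega
  · refine Or.inl fun I hI hadm => ?_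
    rw [admissible_insert_succ_iff hQ hI hadm]
    intro w hw
    have := hadm w i hw
    omega

end Admissible

/-! ### From segment steps to a pair of paths -/

section Construction

variable {P Q : ℕ → ℕ} {n : ℕ}

/-- Append a North step to a path of length `n` that ends at height `t`. -/
def appendNorth (n t : ℕ) (H : ℕ → ℕ) (v : ℕ) : ℕ := if v ≤ n then H v else t + 1

/-- Insert an East step into a path as its `h`-th step. -/
def insertEast (h : ℕ) (H : ℕ → ℕ) (v : ℕ) : ℕ := if v < h then H v else H (v - 1)

theorem IsHeight.appendNorth {H : ℕ → ℕ} (hH : IsHeight H) (n : ℕ) :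
    IsHeight (appendNorth n (H n) H) where
  zero := by simp [_root_.appendNorth, hH.zero]
  le_succ j := by
    have := hH.le_succ j
    have := hH.mono (a := j) (b := n)
    unfold _root_.appendNorth
    split_ifs <;> omega
  succ_le j := by
    have := hH.succ_le j
    unfold _root_.appendNorth
    split_ifs with h1 h2
    · exact this
    · omega
    · obtain rfl : j = n := by omega
      rfl
    · omega

theorem IsHeight.insertEast {H : ℕ → ℕ} (hH : IsHeight H) {h : ℕ} (h1 : 1 ≤ h) :
    IsHeight (insertEast h H) where
  zero := by simp [_root_.insertEast, hH.zero]
  le_succ j := by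
    unfold _root_.insertEast
    split_ifs
    · exact hH.le_succ j
    · exact le_rfl
    · omega
    · exact hH.mono (by omega)
  succ_le j := by
    unfold _root_.insertEast
    split_ifs
    · exact hH.succ_le j
    · omega
    · simp
    · have := hH.succ_le (j - 1)
      rwa [show j - 1 + 1 = j + 1 - 1 by omega] at this

theorem insertEast_le {H : ℕ → ℕ} (hH : IsHeight H) (h v : ℕ) : insertEast h H v ≤ H v := by
  unfold insertEast
  split_ifs
  · exact le_rfl
  · exact hH.mono (by omega)

theorem subset_Icc_succ {J : Set ℕ} (hJ : J ⊆ Set.Icc 1 (n + 1)) :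
    J ⊆ Set.Icc 1 n ∨ ∃ I ⊆ Set.Icc 1 n, J = insert (n + 1) I := by
  by_cases h : n + 1 ∈ J
  · refine Or.inr ⟨J \ {n + 1}, ?_, by rw [Set.insert_sdiff_singleton, Set.insert_eq_of_mem h]⟩
    rintro y ⟨hy, hne⟩
    have := hJ hy
    simp only [Set.mem_singleton_iff, Set.mem_Icc] at *
    omega
  · refine Or.inl fun y hy => ?_
    have h1 := hJ hy
    have h2 : y ≠ n + 1 := fun h' => h (h' ▸ hy)
    simp only [Set.mem_Icc] at *
    omega

/-- The induction step in general form: both families are hereditary, so `insert (n + 1) I` needs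
comparing only when `I` belongs to both. -/
theorem admissible_congr_of_extends {p : Set ℕ → Prop} (hp : ∀ I J, I ⊆ J → p J → p I)
    (hseg : ∀ I ⊆ Set.Icc 1 n, (p I ↔ Admissible P Q I))
    (hins : ∀ I ⊆ Set.Icc 1 n, p I → Admissible P Q I →
      (p (insert (n + 1) I) ↔ Admissible P Q (insert (n + 1) I)))
    {J : Set ℕ} (hJ : J ⊆ Set.Icc 1 (n + 1)) : p J ↔ Admissible P Q J := by
  obtain hJ | ⟨I, hI, rfl⟩ := subset_Icc_succ hJ
  · exact hseg J hJ
  · by_cases hpI : p I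
    · exact hins I hI hpI ((hseg I hI).1 hpI)
    · exact iff_of_false (fun h => hpI (hp _ _ (Set.subset_insert _ _) h))
        fun h => hpI ((hseg I hI).2 (h.subset (Set.subset_insert _ _)))

theorem inter_Ioc_eq_empty {I : Set ℕ} (hI : I ⊆ Set.Icc 1 n) {w v : ℕ} (hw : n ≤ w) :
    I ∩ Set.Ioc w v = ∅ := by
  rw [Set.eq_empty_iff_forall_notMem]
  rintro y ⟨hy, h1, -⟩
  have := (hI hy).2
  omega

/-- On subsets of `[1, n]` only the heights up to `n` matter. -/
theorem Admissible.of_eqOn {P' Q' : ℕ → ℕ} (hPQ' : ∀ j, P' j ≤ Q' j) (hQ' : IsHeight Q')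
    (hP : ∀ v ≤ n, P' v = P v) (hQ : ∀ v ≤ n, Q' v = Q v) {I : Set ℕ} (hI : I ⊆ Set.Icc 1 n)
    (h : Admissible P Q I) : Admissible P' Q' I := by
  intro w v hwv
  by_cases hw : w ≤ n
  · have h1 := h w (min v n) (by omega)
    rw [← hP w hw, ← hQ _ (min_le_right v n)] at h1
    have h2 := hQ'.mono (min_le_left v n)
    have h3 : (I ∩ Set.Ioc w v).ncard ≤ (I ∩ Set.Ioc w (min v n)).ncard := by
      refine ncard_inter_Ioc_mono ?_
      rintro y ⟨hy, h4, h5⟩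
      exact ⟨hy, h4, le_min h5 (hI hy).2⟩
    omega
  · rw [inter_Ioc_eq_empty hI (by omega), Set.ncard_empty, zero_add]
    exact (hPQ' w).trans (hQ'.mono hwv)

/-- A family of sets that is built up by segment steps is given by a pair of paths with the same
endpoints. -/
theorem exists_heights_of_isSegmentStep {p : Set ℕ → Prop} (hp : ∀ I J, I ⊆ J → p J → p I)
    (hp0 : p ∅) (n : ℕ) (hstep : ∀ i < n, IsSegmentStep p i) :
    ∃ (P Q : ℕ → ℕ) (t : ℕ), IsHeight P ∧ IsHeight Q ∧ (∀ j, P j ≤ Q j) ∧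
      (∀ v, n ≤ v → P v = t ∧ Q v = t) ∧ ∀ I ⊆ Set.Icc 1 n, (p I ↔ Admissible P Q I) := by
  induction n with
  | zero =>
    refine ⟨fun _ => 0, fun _ => 0, 0, ⟨rfl, by simp, by simp⟩, ⟨rfl, by simp, by simp⟩, by simp,
      by simp, fun I hI => ?_⟩
    obtain rfl : I = ∅ := Set.subset_empty_iff.1 (by simpa using hI)
    exact iff_of_true hp0 fun w v _ => by simp
  | succ n ih =>
    obtain ⟨P, Q, t, hP, hQ, hPQ, ht, hadm⟩ := ih fun i hi => hstep i (by omega)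
    have hPn := (ht n le_rfl).1
    have hQn := (ht n le_rfl).2
    rcases hstep n (by omega) with h | h | ⟨h, h1, hn, hF, hiff⟩
    -- Isthmus: both paths get a North step, so every window ending at `n + 1` gains one unit of
    -- room.
    · have hP' := hP.appendNorth n
      have hQ' := hQ.appendNorth n
      rw [hPn] at hP'
      rw [hQn] at hQ'
      have hPQ' : ∀ j, appendNorth n t P j ≤ appendNorth n t Q j := by
        intro j
        have := hPQ j
        unfold appendNorth
        split_ifs <;> omega
      have hPe : ∀ v ≤ n, appendNorth n t P v = P v := fun v hv => if_pos hv
      have hQe : ∀ v ≤ n, appendNorth n t Q v = Q v := fun v hv => if_pos hv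
      refine ⟨_, _, t + 1, hP', hQ', hPQ',
        fun v hv => ⟨if_neg (by omega), if_neg (by omega)⟩,
        fun J hJ => admissible_congr_of_extends hp (fun I hI => ?_) (fun I hI hpI hI' => ?_) hJ⟩
      · rw [hadm I hI]
        exact ⟨fun h => h.of_eqOn hPQ' hQ' hPe hQe hI,
          fun h => h.of_eqOn hPQ hQ (fun v hv => (hPe v hv).symm)
            (fun v hv => (hQe v hv).symm) hI⟩
      · refine iff_of_true (h I hI hpI) ((admissible_insert_succ_iff hQ' hI hI').2 fun w hw => ?_)
        have h2 := ((hadm I hI).1 hpI) w n hw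
        rw [hPe w hw, appendNorth, if_neg (by omega)]
        omega
    -- Loop: the heights are already constant from `n` on, so appending East to both paths changes
    -- nothing.
    · refine ⟨P, Q, t, hP, hQ, hPQ, fun v hv => ht v (by omega),
        fun J hJ => admissible_congr_of_extends hp hadm (fun I hI hpI hI' => ?_) hJ⟩
      refine iff_of_false (h I hI) fun hcon => ?_
      have := (admissible_insert_succ_iff hQ hI hI').1 hcon n le_rfl
      have := (ht (n + 1) (by omega)).2
      omega
    -- Principal extension: independence of `[h, n]` bounds `P (h - 1) + (n + 1 - h)` above by `t`,
    -- and `P n = t` bounds it below. So steps `h` to `n` of `P` are all North.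
    · have hFadm := (hadm _ (Set.Icc_subset_Icc_left h1)).1 hF
      have h2 := hFadm (h - 1) n (by omega)
      rw [Set.inter_eq_left.2 (fun y hy => Set.mem_Ioc.2
          ⟨by have := hy.1; omega, by have := hy.2; omega⟩),
        ← Finset.coe_Icc, Set.ncard_coe_finset, Nat.card_Icc] at h2
      have h3 := hP.le_add_sub (show h - 1 ≤ n by omega)
      have hP' := hP.insertEast h1
      have hle := insertEast_le hP h
      have hPQ' : ∀ j, insertEast h P j ≤ Q j := fun j => (hle j).trans (hPQ j)
      have hlt : ∀ w < h, insertEast h P w = P w := fun w hw => if_pos hw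
      have hge : ∀ w, h ≤ w → insertEast h P w = P (w - 1) := fun w hw => if_neg (by omega)
      have hseg : ∀ I ⊆ Set.Icc 1 n, (p I ↔ Admissible (insertEast h P) Q I) := by
        intro I hI
        rw [hadm I hI]
        constructor
        · intro hI' w v hwv
          exact (Nat.add_le_add_left (hle w) _).trans (hI' w v hwv)
        · intro hI' w v hwv
          by_cases hwh : w < h
          · have := hI' w v hwv
            rwa [hlt w hwh] at this
          -- Windows starting in `[h, n]` impose nothing under the old `P`: there `P w = t - (n -
          -- w)`, while `Q` can fall short of `t` at `min v n` by at most `n - min v n`. Lowering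
          -- `P` on them is harmless.
          · have h4 : (I ∩ Set.Ioc w v).ncard ≤ (I ∩ Set.Ioc w (min v n)).ncard := by
              refine ncard_inter_Ioc_mono ?_
              rintro y ⟨hy, h4, h5⟩
              exact ⟨hy, h4, le_min h5 (hI hy).2⟩
            have h5 := ncard_inter_Ioc_le I w (min v n)
            have h6 := hP.le_add_sub (show h - 1 ≤ w by omega)
            have h7 := hQ.le_add_sub (min_le_right v n)
            have h8 := hQ.mono (min_le_left v n)
            by_cases hwn : w ≤ n
            · omega
            · have := (ht w (by omega)).1
              have := (ht v (by omega)).2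
              omega
      refine ⟨_, Q, t, hP', hQ, hPQ',
        fun v hv => ⟨(hge v (by omega)).trans (ht _ (by omega)).1, (ht v (by omega)).2⟩,
        fun J hJ => admissible_congr_of_extends hp hseg (fun I hI hpI hI' => ?_) hJ⟩
      have hsub : ∀ f ∈ Set.Icc h n, insert f I ⊆ Set.Icc 1 n := fun f hf =>
        Set.insert_subset (Set.Icc_subset_Icc_left h1 hf) hI
      rw [hiff I hI hpI, admissible_insert_succ_iff_exists hP' hQ hPQ' h1 hn
        (by rw [hQn, (ht (n + 1) (by omega)).2])
        ((hseg _ (Set.Icc_subset_Icc_left h1)).1 hF) ?_ ?_ hI hI']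
      · refine exists_congr fun f => and_congr_right fun hf => and_congr_right fun _ => ?_
        exact hseg _ (hsub f hf)
      · rw [hlt _ (by omega)]
        omega
      -- The inserted East step makes this inequality strict.
      · intro w hw hwn
        rw [hge w hw]
        have h6 := hP.le_add_sub (show h - 1 ≤ w - 1 by omega)
        omega

end Construction

/-! ### Transfer to a matroid with an ordered ground set -/

/-- The elements of a sequence `x` at the positions in `J`, where positions are counted from `1`. -/
def atPositions {α : Type*} {k : ℕ} (x : Fin k → α) (J : Set ℕ) : Set α :=
  x '' {i | (i : ℕ) + 1 ∈ J}

section Transfer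

variable {α : Type*} {M : Matroid α} {k : ℕ} {x : Fin k → α}

theorem atPositions_mono {I J : Set ℕ} (hIJ : I ⊆ J) : atPositions x I ⊆ atPositions x J :=
  Set.image_mono fun _ hi => hIJ hi

theorem atPositions_empty : atPositions x ∅ = ∅ := by simp [atPositions]

theorem atPositions_insert (i : Fin k) (I : Set ℕ) :
    atPositions x (insert ((i : ℕ) + 1) I) = insert (x i) (atPositions x I) := by
  rw [atPositions, atPositions, ← Set.image_insert_eq]
  congr 1
  ext j
  simp [Fin.ext_iff]

theorem atPositions_Icc (i : Fin k) (h : ℕ) :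
    atPositions x (Set.Icc (h + 1) i) = x '' {j | h ≤ (j : ℕ) ∧ j < i} := by
  rw [atPositions]
  congr 1
  ext j
  simp only [Set.mem_ofPred_eq, Set.mem_Icc, Fin.lt_def]
  omega

theorem mem_atPositions_iff (hx : Function.Injective x) (i : Fin k) (J : Set ℕ) :
    x i ∈ atPositions x J ↔ (i : ℕ) + 1 ∈ J := hx.mem_set_image

theorem exists_eq_atPositions {i : Fin k} {X : Set α} (hX : X ⊆ x '' Set.Iio i) :
    ∃ I ⊆ Set.Icc 1 (i : ℕ), X = atPositions x I := by
  obtain ⟨S, hS, rfl⟩ := Set.subset_image_iff.1 hX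
  refine ⟨(fun j : Fin k => (j : ℕ) + 1) '' S, ?_, ?_⟩
  · rintro _ ⟨j, hj, rfl⟩
    have := Fin.lt_def.1 (hS hj)
    simp only [Set.mem_Icc]
    omega
  · rw [atPositions]
    congr 1
    ext j
    simp [← Fin.ext_iff]

theorem forall_subset_image_Iio_iff {i : Fin k} {q : Set α → Prop} :
    (∀ X ⊆ x '' Set.Iio i, q X) ↔ ∀ I ⊆ Set.Icc 1 (i : ℕ), q (atPositions x I) := by
  constructor
  · intro h I hI
    refine h _ ((atPositions_mono hI).trans ?_)
    refine (atPositions_Icc (x := x) i 0).le.trans (Set.image_mono fun j hj => hj.2)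
  · intro h X hX
    obtain ⟨I, hI, rfl⟩ := exists_eq_atPositions hX
    exact h I hI

/-- Indices in `Fin k` start at `0` and positions at `1`: `x i` sits at position `i + 1`, and
`Set.Ico h i` becomes the segment `[h + 1, i]`. -/
theorem isExtension_iff_isSegmentStep (hx : Function.Injective x) (hE : Set.range x = M.E)
    (i : Fin k) :
    (IsIsthmusExtension (M ↾ (x '' Set.Iio i)) (x i) (M ↾ (x '' Set.Iic i)) ∨
      IsLoopExtension (M ↾ (x '' Set.Iio i)) (x i) (M ↾ (x '' Set.Iic i)) ∨
      ∃ h : Fin k, h < i ∧ (M ↾ (x '' Set.Iio i)).Indep (x '' Set.Ico h i) ∧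
        IsPrincipalExtension (M ↾ (x '' Set.Iio i))
          ((M ↾ (x '' Set.Iio i)).closure (x '' Set.Ico h i)) (x i)
          (M ↾ (x '' Set.Iic i))) ↔
      IsSegmentStep (fun I => M.Indep (atPositions x I)) i := by
  have hA : x '' Set.Iio i ⊆ M.E := hE ▸ Set.image_subset_range _ _
  have he : x i ∈ M.E := hE ▸ Set.mem_range_self i
  have heA : x i ∉ x '' Set.Iio i := by rw [hx.mem_set_image]; simp
  have hIic : x '' Set.Iic i = insert (x i) (x '' Set.Iio i) := by
    rw [← Set.image_insert_eq, Set.Iio_insert]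
  have hIco : ∀ h : Fin k, x '' Set.Ico h i = atPositions x (Set.Icc ((h : ℕ) + 1) i) := fun h => by
    rw [atPositions_Icc]; rfl
  have hsub : ∀ h : Fin k, x '' Set.Ico h i ⊆ x '' Set.Iio i := fun h =>
    Set.image_mono Set.Ico_subset_Iio_self
  rw [hIic, isIsthmusExtension_restrict_iff hA he heA, isLoopExtension_restrict_iff heA,
    IsSegmentStep]
  simp only [atPositions_insert, forall_subset_image_Iio_iff]
  refine or_congr Iff.rfl (or_congr Iff.rfl ?_)
  have key : ∀ h : Fin k, ((M ↾ (x '' Set.Iio i)).Indep (x '' Set.Ico h i) ∧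
        IsPrincipalExtension (M ↾ (x '' Set.Iio i))
          ((M ↾ (x '' Set.Iio i)).closure (x '' Set.Ico h i)) (x i)
          (M ↾ (insert (x i) (x '' Set.Iio i)))) ↔
      (M.Indep (atPositions x (Set.Icc ((h : ℕ) + 1) i)) ∧ ∀ I ⊆ Set.Icc 1 (i : ℕ),
        M.Indep (atPositions x I) → (M.Indep (insert (x i) (atPositions x I)) ↔
          ∃ f ∈ Set.Icc ((h : ℕ) + 1) i, f ∉ I ∧ M.Indep (atPositions x (insert f I)))) := by
    intro h
    rw [isPrincipalExtension_restrict_iff hA he heA (hsub h), Matroid.restrict_indep_iff,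
      and_iff_left (hsub h), forall_subset_image_Iio_iff, ← hIco]
    refine and_congr_right fun _ => forall₂_congr fun I hI => imp_congr_right fun _ =>
      iff_congr Iff.rfl ?_
    constructor
    · rintro ⟨_, ⟨j, hj, rfl⟩, hjI, hj'⟩
      have hj1 := Fin.le_def.1 hj.1
      have hj2 := Fin.lt_def.1 hj.2
      refine ⟨(j : ℕ) + 1, ⟨by omega, by omega⟩, ?_, ?_⟩
      · rwa [mem_atPositions_iff hx] at hjI
      · rwa [atPositions_insert]
    · rintro ⟨f, ⟨hf1, hf2⟩, hfI, hf⟩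
      obtain ⟨j, rfl⟩ : ∃ j : Fin k, f = (j : ℕ) + 1 := by
        have hik := i.2
        exact ⟨⟨f - 1, by omega⟩, by simp only; omega⟩
      refine ⟨x j, ⟨j, ⟨?_, ?_⟩, rfl⟩, ?_, ?_⟩
      · rw [Fin.le_def]; omega
      · rw [Fin.lt_def]; omega
      · rwa [mem_atPositions_iff hx]
      · rwa [atPositions_insert] at hf
  constructor
  · rintro ⟨h, hlt, hh⟩
    exact ⟨(h : ℕ) + 1, by omega, Fin.lt_def.1 hlt, (key h).1 hh⟩
  · rintro ⟨h, h1, hle, hh⟩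
    have hik := i.2
    obtain ⟨l, rfl⟩ := Nat.exists_eq_add_of_le' h1
    exact ⟨⟨l, by omega⟩, Fin.lt_def.2 hle, (key ⟨l, by omega⟩).2 hh⟩

/-- The isomorphism is absorbed into the ordering `x`. Heights that are constantly `t` from `k` on
encode two paths with common endpoint `(k - t, t)`. -/
theorem isLatticePathMatroid_iff_exists_heights :
    IsLatticePathMatroid M ↔ ∃ (k : ℕ) (x : Fin k → α), Function.Injective x ∧
      Set.range x = M.E ∧ ∃ (P Q : ℕ → ℕ) (t : ℕ), IsHeight P ∧ IsHeight Q ∧ (∀ j, P j ≤ Q j) ∧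
        (∀ v, k ≤ v → P v = t ∧ Q v = t) ∧
        ∀ I ⊆ Set.Icc 1 k, (M.Indep (atPositions x I) ↔ Admissible P Q I) := by
  constructor
  · rintro ⟨m, r, P, Q, hP, hQ, hPQ, e, he⟩
    let y : Fin (m + r) → (latticePathMatroid m r P Q).E :=
      fun i => ⟨(i : ℕ) + 1, by
        rw [latticePathMatroid_ground]; exact ⟨by omega, by omega⟩⟩
    have hy : Function.Injective y := fun a b hab => by
      have := congrArg Subtype.val hab
      simp only [y] at this
      exact Fin.ext (by omega)
    refine ⟨m + r, fun i => e.symm (y i), ?_, ?_, pathHeight P, pathHeight Q, r,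
      isHeight_pathHeight P, isHeight_pathHeight Q, hPQ,
      fun v hv => ⟨hP.pathHeight_of_le hv, hQ.pathHeight_of_le hv⟩, fun I hI => ?_⟩
    · exact Subtype.val_injective.comp (e.symm.injective.comp hy)
    · ext a
      constructor
      · rintro ⟨i, rfl⟩
        exact (e.symm (y i)).2
      · intro ha
        have h1 : (e ⟨a, ha⟩ : ℕ) ∈ Set.Icc 1 (m + r) := (e ⟨a, ha⟩).2
        refine ⟨⟨(e ⟨a, ha⟩ : ℕ) - 1, by have := h1.1; have := h1.2; omega⟩, ?_⟩
        have : y ⟨(e ⟨a, ha⟩ : ℕ) - 1, by have := h1.1; have := h1.2; omega⟩ = e ⟨a, ha⟩ := by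
          apply Subtype.ext
          have := h1.1
          simp only [y]
          omega
        simp only [this, Equiv.symm_apply_apply]
    · have h1 := he {a | (e a : ℕ) ∈ I}
      have h2 : (fun a : M.E => (e a : ℕ)) '' {a | (e a : ℕ) ∈ I} = I := by
        ext j
        constructor
        · rintro ⟨a, ha, rfl⟩
          exact ha
        · intro hj
          refine ⟨e.symm ⟨j, hI hj⟩, ?_, ?_⟩ <;> simp [hj]
      have h3 : (fun a : M.E => (a : α)) '' {a | (e a : ℕ) ∈ I} =
          atPositions (fun i => (e.symm (y i) : α)) I := by
        ext a
        constructor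
        · rintro ⟨b, hb, rfl⟩
          have hb' := hI hb
          have h4 : y ⟨(e b : ℕ) - 1, by have := hb'.1; have := hb'.2; omega⟩ = e b := by
            apply Subtype.ext
            have := hb'.1
            simp only [y]
            omega
          refine ⟨⟨(e b : ℕ) - 1, by have := hb'.1; have := hb'.2; omega⟩, ?_, ?_⟩
          · have := congrArg Subtype.val h4
            simp only [y] at this
            simp only [Set.mem_ofPred_eq, this]
            exact hb
          · simp only [h4, Equiv.symm_apply_apply]
        · rintro ⟨i, hi, rfl⟩
          refine ⟨e.symm (y i), ?_, rfl⟩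
          simpa [y] using hi
      rw [h2, h3, latticePathMatroid_indep_iff hP hQ hPQ, and_iff_right hI] at h1
      exact h1
  · rintro ⟨k, x, hx, hE, P, Q, t, hP, hQ, hPQ, ht, hadm⟩
    have hPk := (ht k le_rfl).1
    have hQk := (ht k le_rfl).2
    obtain ⟨P, hPl, rfl⟩ := hP.exists_list (n := k) fun j hj => by rw [(ht j hj).1, hPk]
    obtain ⟨Q, hQl, rfl⟩ := hQ.exists_list (n := k) fun j hj => by rw [(ht j hj).2, hQk]
    rw [hPk] at hPl
    rw [hQk] at hQl
    have htk : t ≤ k := by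
      have := hP.le_add 0 k
      rw [hP.zero, zero_add] at this
      omega
    have hN : (latticePathMatroid (k - t) t P Q).E = Set.Icc 1 k := by
      rw [latticePathMatroid_ground, Nat.sub_add_cancel htk]
    refine ⟨k - t, t, P, Q, hPl, hQl, hPQ, ?_⟩
    let y : Fin k → (latticePathMatroid (k - t) t P Q).E :=
      fun i => ⟨(i : ℕ) + 1, by rw [hN]; exact ⟨by omega, by omega⟩⟩
    have hy : Function.Bijective y := by
      constructor
      · intro a b hab
        have := congrArg Subtype.val hab
        simp only [y] at this
        exact Fin.ext (by omega)
      · rintro ⟨j, hj⟩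
        rw [hN] at hj
        refine ⟨⟨j - 1, by have := hj.1; have := hj.2; omega⟩, Subtype.ext ?_⟩
        have := hj.1
        simp only [y]
        omega
    let e₁ : Fin k ≃ M.E := (Equiv.ofInjective x hx).trans (Equiv.setCongr hE)
    have he₁ : ∀ i, (e₁ i : α) = x i := fun i => rfl
    refine ⟨e₁.symm.trans (Equiv.ofBijective y hy), fun I => ?_⟩
    have h1 : (fun a : M.E => ((e₁.symm.trans (Equiv.ofBijective y hy)) a : ℕ)) '' I =
        (fun i : Fin k => (i : ℕ) + 1) '' (e₁ ⁻¹' I) := by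
      rw [← Equiv.image_symm_eq_preimage, Set.image_image]
      rfl
    have h2 : (fun a : M.E => (a : α)) '' I =
        atPositions x ((fun i : Fin k => (i : ℕ) + 1) '' (e₁ ⁻¹' I)) := by
      rw [atPositions]
      ext a
      constructor
      · rintro ⟨b, hb, rfl⟩
        refine ⟨e₁.symm b, ⟨e₁.symm b, by simpa using hb, rfl⟩, ?_⟩
        rw [← he₁, Equiv.apply_symm_apply]
      · rintro ⟨i, ⟨j, hj, hij⟩, rfl⟩
        obtain rfl : j = i := Fin.ext (by simpa using hij)
        exact ⟨e₁ j, hj, he₁ j⟩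
    have h3 : (fun i : Fin k => (i : ℕ) + 1) '' (e₁ ⁻¹' I) ⊆ Set.Icc 1 k := by
      rintro _ ⟨i, -, rfl⟩
      exact ⟨by simp, i.2⟩
    rw [h1, h2, hadm _ h3, latticePathMatroid_indep_iff hPl hQl hPQ, Nat.sub_add_cancel htk,
      and_iff_right h3]

end Transfer

/-! ### Proof of the theorem -/

theorem IsSegmentStep.congr {p q : Set ℕ → Prop} {i : ℕ}
    (hpq : ∀ I ⊆ Set.Icc 1 (i + 1), (p I ↔ q I)) (hp : IsSegmentStep p i) : IsSegmentStep q i := by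
  have hseg : ∀ I ⊆ Set.Icc 1 i, (p I ↔ q I) := fun I hI =>
    hpq I (hI.trans (Set.Icc_subset_Icc_right (by omega)))
  have hins : ∀ f, 1 ≤ f → f ≤ i + 1 → ∀ I ⊆ Set.Icc 1 i, (p (insert f I) ↔ q (insert f I)) :=
    fun f h1 h2 I hI =>
      hpq _ (Set.insert_subset ⟨h1, h2⟩ (hI.trans (Set.Icc_subset_Icc_right (by omega))))
  rcases hp with h | h | ⟨h, h1, hi, hF, hiff⟩
  · exact Or.inl fun I hI hq =>
      (hins _ (by omega) le_rfl I hI).1 (h I hI ((hseg I hI).2 hq))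
  · exact Or.inr (Or.inl fun I hI hq => h I hI ((hins _ (by omega) le_rfl I hI).2 hq))
  · refine Or.inr (Or.inr ⟨h, h1, hi, (hseg _ (Set.Icc_subset_Icc_left h1)).1 hF,
      fun I hI hq => ?_⟩)
    rw [← hins _ (by omega) le_rfl I hI, hiff I hI ((hseg I hI).2 hq)]
    refine exists_congr fun f => and_congr_right fun hf => and_congr_right fun _ => ?_
    exact hins f (h1.trans hf.1) (hf.2.trans (by omega)) I hI

/-- For a fixed ordering, being given by a pair of paths and being built by segment steps are the
same condition. -/
theorem theorem6p7 {α : Type*} (M : Matroid α) :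
    IsLatticePathMatroid M ↔
      ∃ (k : ℕ) (x : Fin k → α), Function.Injective x ∧ Set.range x = M.E ∧
        ∀ i : Fin k,
          IsIsthmusExtension (M ↾ (x '' Set.Iio i)) (x i) (M ↾ (x '' Set.Iic i)) ∨
          IsLoopExtension (M ↾ (x '' Set.Iio i)) (x i) (M ↾ (x '' Set.Iic i)) ∨
          ∃ h : Fin k, h < i ∧
            (M ↾ (x '' Set.Iio i)).Indep (x '' Set.Ico h i) ∧
            IsPrincipalExtension (M ↾ (x '' Set.Iio i))
              ((M ↾ (x '' Set.Iio i)).closure (x '' Set.Ico h i)) (x i)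
              (M ↾ (x '' Set.Iic i)) := by
  rw [isLatticePathMatroid_iff_exists_heights]
  refine exists_congr fun k => exists_congr fun x => and_congr_right fun hx =>
    and_congr_right fun hE => ?_
  simp only [isExtension_iff_isSegmentStep hx hE]
  constructor
  · rintro ⟨P, Q, t, hP, hQ, hPQ, -, hadm⟩ i
    refine (isSegmentStep_admissible hP hQ hPQ i).congr fun I hI => ?_
    exact (hadm I (hI.trans (Set.Icc_subset_Icc_right i.2))).symm
  · intro hstep
    exact exists_heights_of_isSegmentStep (fun I J hIJ hJ => hJ.subset (atPositions_mono hIJ))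
      (by rw [atPositions_empty]; exact M.empty_indep) k fun i hi => hstep ⟨i, hi⟩
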